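/- **Proposition 4.2.** Let $T\ge 0$ and $C$ be real constants. For each $i\in\mathbb N$ let $M_i$ be a connected smooth manifold of dimension $n$ (without boundary), $p_i\in M_i$, and $(g_i(t))_{t\in[0,T]}$ a family of complete smooth Riemannian metrics on $M_i$ such that, for every tangent vector $V$ of $M_i$, the function $t\mapsto g_i(t)[V,V]$ is differentiable on $[0,T]$ (one-sidedly at the end points) and $$\left|\tfrac{\partial}{\partial t}g_i(t)[V,V]\right|\le C\,g_i(t)[V,V]\qquad\text{for all } i,\ V \text{ and } t\in[0,T].$$ For each $t\in[0,T]$ let $(X_\infty(t),d_\infty(t),x_\infty(t))$ be a complete pointed metric space to which the sequence $(M_i,d_{g_i(t)},p_i)$ converges in the pointed Gromov–Hausdorff topology, where $d_{g}$ is the Riemannian distance of $g$. This convergence means $d_{GH}\to 0$, where $d_{GH}((X,x_0),(Y,y_0))$ is the infimum of the $\varepsilon>0$ for which there are $\varepsilon$-pointed Gromov–Hausdorff approximations $(X,x_0)\to(Y,y_0)$ and $(Y,y_0)\to(X,x_0)$; such an approximation is a (not necessarily continuous) map $f:X\to Y$ with $f(x_0)=y_0$, with $|d_X(x,x')-d_Y(f(x),f(x'))|<\varepsilon$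 for all $x,x'\in B_X(x_0,1/\varepsilon)$, and such that every point of $B_Y(y_0,1/\varepsilon-\varepsilon)$ is at distance less than $\varepsilon$ from a point of $f(B_X(x_0,1/\varepsilon))$. Then for every $t\in[0,T]$ there is a homeomorphism $X_\infty(t)\to X_\infty(0)$ taking $x_\infty(t)$ to $x_\infty(0)$. Moreover these homeomorphisms can be chosen so that they and their inverses are Lipschitz with a constant $K<\infty$ independent of $t$. -/

import Mathlib

open Set Filter Topology Metric Manifold Bundle
open scoped ContDiff NNReal

/-- A pointed metric space `(X, d, x₀)`. -/
structure PointedMetricSpace where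
  /-- The underlying set. -/
  carrier : Type*
  /-- The distance function. -/
  [metric : MetricSpace carrier]
  /-- The base point. -/
  pt : carrier

attribute [instance] PointedMetricSpace.metric

namespace PointedMetricSpace

/-- `f` is an `ε`-pointed Gromov-Hausdorff approximation `(X, x₀) → (Y, y₀)`: it maps `x₀` to `y₀`,
the ball `B(y₀, 1/ε - ε)` is contained in the `ε`-neighbourhood of `f (B(x₀, 1/ε))`, and `f`
distorts distances in `B(x₀, 1/ε)` by less than `ε`. No continuity is required. -/
structure IsGHApprox (X Y : PointedMetricSpace) (ε : ℝ) (f : X.carrier → Y.carrier) : Prop where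
  map_pt : f X.pt = Y.pt
  ball_subset : ball Y.pt (1 / ε - ε) ⊆ thickening ε (f '' ball X.pt (1 / ε))
  abs_dist_sub_dist_lt : ∀ x ∈ ball X.pt (1 / ε), ∀ x' ∈ ball X.pt (1 / ε),
    |dist x x' - dist (f x) (f x')| < ε

/-- The pointed Gromov-Hausdorff distance. The infimum is over a set that is bounded below by `0`
and nonempty (it contains every `ε ≥ 2`, through constant maps). -/
noncomputable def ghDist (X Y : PointedMetricSpace) : ℝ :=
  sInf {ε : ℝ | 0 < ε ∧ (∃ f, IsGHApprox X Y ε f) ∧ ∃ h, IsGHApprox Y X ε h}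

/-- Convergence of a sequence in the pointed Gromov-Hausdorff topology. -/
def GHTendsto (X : ℕ → PointedMetricSpace) (Y : PointedMetricSpace) : Prop :=
  Tendsto (fun i => ghDist (X i) Y) atTop (𝓝 0)

end PointedMetricSpace

theorem edist_ne_top_of_connectedSpace {M : Type*} [EMetricSpace M] [ConnectedSpace M] (x y : M) :
    edist x y ≠ ⊤ := by
  have h : IsClopen (eball x ⊤) := ⟨isClosed_eball_top, isOpen_eball⟩
  have hu : eball x ⊤ = univ := h.eq_univ ⟨x, by simp⟩
  have hy : y ∈ eball x ⊤ := hu ▸ mem_univ y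
  have h2 : edist x y < ⊤ := by simpa [edist_comm] using hy
  exact h2.ne

/-- A smooth Riemannian metric on an `n`-dimensional manifold `M` (without boundary). -/
abbrev SmoothRiemannianMetric (n : ℕ) (M : Type*) [TopologicalSpace M]
    [ChartedSpace (EuclideanSpace ℝ (Fin n)) M] [IsManifold (𝓡 n) ∞ M] :=
  ContMDiffRiemannianMetric (𝓡 n) ∞ (EuclideanSpace ℝ (Fin n))
    (fun x : M => TangentSpace (𝓡 n) x)

namespace SmoothRiemannianMetric

variable {n : ℕ} {M : Type*} [TopologicalSpace M]
  [ChartedSpace (EuclideanSpace ℝ (Fin n)) M] [IsManifold (𝓡 n) ∞ M] [T2Space M]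

/-- The extended distance of a Riemannian metric `g`: the infimum of the `g`-lengths of the `C^1`
paths between two points (`⊤` if there are none). Its topology is the manifold topology. -/
noncomputable abbrev toEMetricSpace (g : SmoothRiemannianMetric n M) : EMetricSpace M :=
  haveI : IsManifold (𝓡 n) 1 M := IsManifold.of_le (n := ∞) (by norm_cast)
  haveI : LocallyCompactSpace M := ChartedSpace.locallyCompactSpace (EuclideanSpace ℝ (Fin n)) M
  letI : RiemannianBundle (fun x : M => TangentSpace (𝓡 n) x) := ⟨g.toRiemannianMetric⟩
  haveI : IsContinuousRiemannianBundle (EuclideanSpace ℝ (Fin n))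
      (fun x : M => TangentSpace (𝓡 n) x) := ⟨⟨g.inner, g.contMDiff.continuous, fun _ _ _ => rfl⟩⟩
  EMetricSpace.ofRiemannianMetric (𝓡 n) M

theorem toEMetricSpace_edist_ne_top [hM : ConnectedSpace M] (g : SmoothRiemannianMetric n M)
    (x y : M) : g.toEMetricSpace.edist x y ≠ ⊤ :=
  @edist_ne_top_of_connectedSpace M g.toEMetricSpace hM x y

/-- The distance `d_g` of a Riemannian metric `g` on a connected manifold, as a metric space. -/
noncomputable abbrev toMetricSpace [ConnectedSpace M] (g : SmoothRiemannianMetric n M) :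
    MetricSpace M :=
  letI := g.toEMetricSpace
  EMetricSpace.toMetricSpace g.toEMetricSpace_edist_ne_top

/-- The pointed metric space `(M, d_g, p)`. -/
noncomputable def toPointed [ConnectedSpace M] (g : SmoothRiemannianMetric n M) (p : M) :
    PointedMetricSpace :=
  letI := g.toMetricSpace
  ⟨M, p⟩

end SmoothRiemannianMetric

/-! By a Gronwall argument the derivative bound makes `g_i(t)` and `g_i(0)` comparable up to a
factor independent of `i` and `t`. Comparing lengths of paths, the identity of `M_i` is bi-Lipschitz
between the two distances, with one constant for all `i` and `t`.

Such maps pass to the limit (`GHTendsto.exists_homeomorph`). Represent `x` in the first limit by a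
bounded sequence of `m i`, regard it in the second sequence of spaces, and take its limit there.
Distances converge along bounded sequences, so the limit map is well defined and bi-Lipschitz. The
limits exist because balls of the limit spaces are compact: balls of the complete manifolds are
compact by Hopf-Rinow, and total boundedness survives Gromov-Hausdorff limits. -/

namespace PointedMetricSpace

/-! ### Pointed Gromov-Hausdorff limits -/

/-- Keeps the infimum in `ghDist` from being the default value `0` of `sInf ∅`. At `ε = 2` the ball
to be covered has negative radius. -/
theorem isGHApprox_const (X Y : PointedMetricSpace) : IsGHApprox X Y 2 fun _ => Y.pt where
  map_pt := rfl
  ball_subset := by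
    have h : ball Y.pt (1 / 2 - 2) = ∅ := ball_eq_empty.2 (by norm_num)
    rw [h]
    exact empty_subset _
  abs_dist_sub_dist_lt x hx x' hx' := by
    have h := dist_triangle_right x x' X.pt
    rw [mem_ball] at hx hx'
    rw [dist_self, sub_zero, abs_of_nonneg dist_nonneg]
    linarith

theorem GHTendsto.exists_isGHApprox {A : ℕ → PointedMetricSpace} {X : PointedMetricSpace}
    (h : GHTendsto A X) :
    ∃ (ε : ℕ → ℝ) (f : ∀ i, (A i).carrier → X.carrier), Tendsto ε atTop (𝓝 0) ∧
      (∀ i, 0 < ε i) ∧ ∀ i, IsGHApprox (A i) X (ε i) (f i) := by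
  have key : ∀ i, ∃ ε : ℝ, ε < ghDist (A i) X + 1 / ((i : ℝ) + 1) ∧ 0 < ε ∧
      ∃ f, IsGHApprox (A i) X ε f := by
    intro i
    have hne : {ε : ℝ | 0 < ε ∧ (∃ f, IsGHApprox (A i) X ε f) ∧
        ∃ h, IsGHApprox X (A i) ε h}.Nonempty :=
      ⟨2, two_pos, ⟨_, isGHApprox_const _ _⟩, ⟨_, isGHApprox_const _ _⟩⟩
    obtain ⟨ε, ⟨hε, hf, -⟩, hlt⟩ := exists_lt_of_csInf_lt hne
      (lt_add_of_pos_right (ghDist (A i) X) (Nat.one_div_pos_of_nat (α := ℝ) (n := i)))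
    exact ⟨ε, hlt, hε, hf⟩
  choose ε hlt hpos f hf using key
  refine ⟨ε, f, ?_, hpos, hf⟩
  refine tendsto_of_tendsto_of_tendsto_of_le_of_le tendsto_const_nhds ?_
    (fun i => (hpos i).le) (fun i => (hlt i).le)
  simpa using Tendsto.add h (tendsto_one_div_add_atTop_nhds_zero_nat (𝕜 := ℝ))

section Approx

variable {A : ℕ → PointedMetricSpace} {X : PointedMetricSpace} {ε : ℕ → ℝ}
  {f : ∀ i, (A i).carrier → X.carrier}

theorem eventually_lt_one_div {ε : ℕ → ℝ} (hε : Tendsto ε atTop (𝓝 0)) (hpos : ∀ i, 0 < ε i)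
    (R : ℝ) : ∀ᶠ i in atTop, R < 1 / ε i := by
  have h : Tendsto (fun i => 1 / ε i) atTop atTop := by
    simp only [one_div]
    exact (tendsto_nhdsWithin_iff.2 ⟨hε, .of_forall hpos⟩).inv_tendsto_nhdsGT_zero
  exact h.eventually_gt_atTop R

/-- Distances of bounded sequences pass to the limit along Gromov-Hausdorff approximations. -/
theorem tendsto_dist_of_isGHApprox (hε : Tendsto ε atTop (𝓝 0)) (hpos : ∀ i, 0 < ε i)
    (hf : ∀ i, IsGHApprox (A i) X (ε i) (f i)) {U : Filter ℕ} (hU : U ≤ atTop)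
    {m m' : ∀ i, (A i).carrier} {R R' : ℝ} (hm : ∀ᶠ i in U, dist (m i) (A i).pt ≤ R)
    (hm' : ∀ᶠ i in U, dist (m' i) (A i).pt ≤ R') {x x' : X.carrier}
    (hx : Tendsto (fun i => f i (m i)) U (𝓝 x)) (hx' : Tendsto (fun i => f i (m' i)) U (𝓝 x')) :
    Tendsto (fun i => dist (m i) (m' i)) U (𝓝 (dist x x')) := by
  have h0 : Tendsto (fun i => dist (m i) (m' i) - dist (f i (m i)) (f i (m' i))) U (𝓝 0) := by
    refine squeeze_zero_norm' ?_ (hε.mono_left hU)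
    filter_upwards [hm, hm', hU (eventually_lt_one_div hε hpos R),
      hU (eventually_lt_one_div hε hpos R')] with i h1 h2 h3 h4
    exact ((hf i).abs_dist_sub_dist_lt _ (h1.trans_lt h3) _ (h2.trans_lt h4)).le
  simpa using h0.add (hx.dist hx')

/-- Every point of the limit space is the limit of a bounded sequence. -/
theorem exists_tendsto_of_isGHApprox (hε : Tendsto ε atTop (𝓝 0)) (hpos : ∀ i, 0 < ε i)
    (hf : ∀ i, IsGHApprox (A i) X (ε i) (f i)) (x : X.carrier) :
    ∃ m : ∀ i, (A i).carrier, (∀ᶠ i in atTop, dist (m i) (A i).pt ≤ dist x X.pt + 2) ∧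
      Tendsto (fun i => f i (m i)) atTop (𝓝 x) := by
  have key : ∀ i, ∃ m : (A i).carrier, x ∈ ball X.pt (1 / ε i - ε i) →
      m ∈ ball (A i).pt (1 / ε i) ∧ dist x (f i m) < ε i := by
    intro i
    by_cases hx : x ∈ ball X.pt (1 / ε i - ε i)
    · obtain ⟨_, ⟨m, hm, rfl⟩, hd⟩ := mem_thickening_iff.1 ((hf i).ball_subset hx)
      exact ⟨m, fun _ => ⟨hm, hd⟩⟩
    · exact ⟨(A i).pt, fun h => absurd h hx⟩
  choose m hm using key
  have hev : ∀ᶠ i in atTop, ε i < 1 ∧ x ∈ ball X.pt (1 / ε i - ε i) := by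
    filter_upwards [hε.eventually (gt_mem_nhds one_pos),
      eventually_lt_one_div hε hpos (dist x X.pt + 1)] with i h1 h2
    exact ⟨h1, by rw [mem_ball]; linarith⟩
  refine ⟨m, ?_, ?_⟩
  · filter_upwards [hev] with i ⟨h1, h2⟩
    obtain ⟨h3, h4⟩ := hm i h2
    -- The `2` in the bound: one `ε i < 1` for distortion, one for the distance from `f i (m i)` to
    -- `x`.
    have h5 := (hf i).abs_dist_sub_dist_lt _ h3 _ (mem_ball_self (one_div_pos.2 (hpos i)))
    rw [(hf i).map_pt] at h5
    have h6 := (abs_lt.1 h5).2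
    have h7 := dist_triangle_left (f i (m i)) X.pt x
    linarith
  · rw [tendsto_iff_dist_tendsto_zero]
    refine squeeze_zero' (.of_forall fun _ => dist_nonneg) ?_ hε
    filter_upwards [hev] with i ⟨_, h2⟩
    rw [dist_comm]
    exact (hm i h2).2.le

/-- A complete pointed Gromov-Hausdorff limit of spaces with compact balls has compact balls. -/
theorem isCompact_closedBall_of_isGHApprox (hε : Tendsto ε atTop (𝓝 0)) (hpos : ∀ i, 0 < ε i)
    (hf : ∀ i, IsGHApprox (A i) X (ε i) (f i)) [CompleteSpace X.carrier]
    (hA : ∀ i R, IsCompact (closedBall (A i).pt R)) (R : ℝ) : IsCompact (closedBall X.pt R) := by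
  refine TotallyBounded.isCompact_of_isClosed ?_ isClosed_closedBall
  rw [Metric.totallyBounded_iff]
  intro δ hδ
  obtain ⟨i, h1, h2, h3⟩ := ((hε.eventually (gt_mem_nhds one_pos)).and
    ((hε.eventually (gt_mem_nhds (show (0 : ℝ) < δ / 3 by positivity))).and
    (eventually_lt_one_div hε hpos (R + 1)))).exists
  have htb : TotallyBounded (ball (A i).pt (1 / ε i)) :=
    (hA i (1 / ε i)).totallyBounded.subset ball_subset_closedBall
  -- The net must lie inside the ball, where distortion is controlled; its image is then a `3 * ε
  -- i`-net.
  obtain ⟨t, hts, htf, ht⟩ := totallyBounded_iff_subset.1 htb _ (dist_mem_uniformity (hpos i))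
  refine ⟨f i '' t, htf.image _, fun x hx => ?_⟩
  rw [mem_closedBall] at hx
  obtain ⟨_, ⟨m, hm, rfl⟩, hd⟩ := mem_thickening_iff.1 ((hf i).ball_subset
    (show x ∈ ball X.pt (1 / ε i - ε i) by rw [mem_ball]; linarith))
  obtain ⟨y, hy, hmy⟩ := mem_iUnion₂.1 (ht hm)
  have hmy : dist m y < ε i := hmy
  refine mem_iUnion₂.2 ⟨f i y, mem_image_of_mem _ hy, ?_⟩
  have h4 := (abs_lt.1 ((hf i).abs_dist_sub_dist_lt _ hm _ (hts hy))).1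
  have h5 := dist_triangle x (f i m) (f i y)
  rw [mem_ball]
  linarith

/-- Bounded sequences converge along ultrafilters if the limit space has compact balls. -/
theorem exists_ultrafilter_limit_of_isGHApprox (hε : Tendsto ε atTop (𝓝 0)) (hpos : ∀ i, 0 < ε i)
    (hf : ∀ i, IsGHApprox (A i) X (ε i) (f i)) (hX : ∀ R, IsCompact (closedBall X.pt R))
    {U : Ultrafilter ℕ} (hU : (U : Filter ℕ) ≤ atTop) {m : ∀ i, (A i).carrier} {R : ℝ}
    (hm : ∀ᶠ i in U, dist (m i) (A i).pt ≤ R) :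
    ∃ x, Tendsto (fun i => f i (m i)) U (𝓝 x) := by
  have hmem : ∀ᶠ i in U, f i (m i) ∈ closedBall X.pt (R + 1) := by
    filter_upwards [hm, hU (hε.eventually (gt_mem_nhds one_pos)),
      hU (eventually_lt_one_div hε hpos R)] with i h1 h2 h3
    have h4 := (hf i).abs_dist_sub_dist_lt _ (show m i ∈ ball _ _ from h1.trans_lt h3) _
      (mem_ball_self (one_div_pos.2 (hpos i)))
    rw [(hf i).map_pt] at h4
    have h5 := (abs_lt.1 h4).1
    rw [mem_closedBall]
    linarith
  obtain ⟨x, -, hx⟩ := (hX (R + 1)).ultrafilter_le_nhds (U.map fun i => f i (m i))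
    (le_principal_iff.2 hmem)
  exact ⟨x, hx⟩

end Approx

/-- Uniformly bi-Lipschitz sequences of pointed spaces with compact balls have bi-Lipschitz complete
pointed Gromov-Hausdorff limits. -/
theorem GHTendsto.exists_homeomorph {A B : ℕ → PointedMetricSpace} {X Y : PointedMetricSpace}
    (hAX : GHTendsto A X) (hBY : GHTendsto B Y) [CompleteSpace X.carrier] [CompleteSpace Y.carrier]
    (hA : ∀ i R, IsCompact (closedBall (A i).pt R)) (hB : ∀ i R, IsCompact (closedBall (B i).pt R))
    (e : ∀ i, (A i).carrier ≃ (B i).carrier) (he : ∀ i, e i (A i).pt = (B i).pt) (K : ℝ≥0)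
    (hK : ∀ i, LipschitzWith K (e i)) (hK' : ∀ i, LipschitzWith K (e i).symm) :
    ∃ F : X.carrier ≃ₜ Y.carrier, F X.pt = Y.pt ∧ LipschitzWith K F ∧ LipschitzWith K F.symm := by
  obtain ⟨ε, f, hε, hεpos, hf⟩ := hAX.exists_isGHApprox
  obtain ⟨δ, h, hδ, hδpos, hh⟩ := hBY.exists_isGHApprox
  have hXc := isCompact_closedBall_of_isGHApprox hε hεpos hf hA
  have hYc := isCompact_closedBall_of_isGHApprox hδ hδpos hh hB
  -- A nonprincipal ultrafilter gives all limits at once, without diagonal subsequences.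
  have hU := Nat.hyperfilter_le_atTop
  set U := hyperfilter ℕ
  have hbd : ∀ {m : ∀ i, (A i).carrier} {R : ℝ}, (∀ᶠ i in U, dist (m i) (A i).pt ≤ R) →
      ∀ᶠ i in U, dist (e i (m i)) (B i).pt ≤ K * R := by
    intro m R hm
    filter_upwards [hm] with i hi
    rw [← he i]
    exact ((hK i).dist_le_mul _ _).trans (by gcongr)
  have hbd' : ∀ {m : ∀ i, (B i).carrier} {R : ℝ}, (∀ᶠ i in U, dist (m i) (B i).pt ≤ R) →
      ∀ᶠ i in U, dist ((e i).symm (m i)) (A i).pt ≤ K * R := by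
    intro m R hm
    filter_upwards [hm] with i hi
    rw [← (e i).symm_apply_apply (A i).pt, he i]
    exact ((hK' i).dist_le_mul _ _).trans (by gcongr)
  choose m hm hmx using fun x => exists_tendsto_of_isGHApprox hε hεpos hf x
  replace hm := fun x => hU (hm x)
  replace hmx := fun x => (hmx x).mono_left hU
  choose F hF using fun x => exists_ultrafilter_limit_of_isGHApprox hδ hδpos hh hYc hU (hbd (hm x))
  -- `F x` does not depend on the representing sequence; this gives surjectivity and the base point.
  have hFd : ∀ {x R y} {m' : ∀ i, (A i).carrier}, (∀ᶠ i in U, dist (m' i) (A i).pt ≤ R) →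
      Tendsto (fun i => f i (m' i)) U (𝓝 x) → Tendsto (fun i => h i (e i (m' i))) U (𝓝 y) →
      F x = y := by
    intro x R y m' h1 h2 h3
    have h4 := tendsto_dist_of_isGHApprox hε hεpos hf hU (hm x) h1 (hmx x) h2
    have h5 := tendsto_dist_of_isGHApprox hδ hδpos hh hU (hbd (hm x)) (hbd h1) (hF x) h3
    have h6 := le_of_tendsto_of_tendsto' h5 (h4.const_mul (K : ℝ))
      fun i => (hK i).dist_le_mul _ _
    rw [dist_self, mul_zero] at h6
    exact dist_le_zero.1 h6
  have hFl : LipschitzWith K F := LipschitzWith.of_dist_le_mul fun x x' =>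
    le_of_tendsto_of_tendsto'
      (tendsto_dist_of_isGHApprox hδ hδpos hh hU (hbd (hm x)) (hbd (hm x')) (hF x) (hF x'))
      ((tendsto_dist_of_isGHApprox hε hεpos hf hU (hm x) (hm x') (hmx x) (hmx x')).const_mul _)
      fun i => (hK i).dist_le_mul _ _
  have hFa : AntilipschitzWith K F := AntilipschitzWith.of_le_mul_dist fun x x' =>
    le_of_tendsto_of_tendsto'
      (tendsto_dist_of_isGHApprox hε hεpos hf hU (hm x) (hm x') (hmx x) (hmx x'))
      ((tendsto_dist_of_isGHApprox hδ hδpos hh hU (hbd (hm x)) (hbd (hm x')) (hF x)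
        (hF x')).const_mul _)
      fun i => by simpa using (hK' i).dist_le_mul (e i (m x i)) (e i (m x' i))
  have hFs : Function.Surjective F := by
    intro y
    obtain ⟨b, hb, hby⟩ := exists_tendsto_of_isGHApprox hδ hδpos hh y
    have hb' := hbd' (hU hb)
    obtain ⟨x, hx⟩ := exists_ultrafilter_limit_of_isGHApprox hε hεpos hf hXc hU hb'
    exact ⟨x, hFd hb' hx (by simpa using hby.mono_left hU)⟩
  let E : X.carrier ≃ Y.carrier := Equiv.ofBijective F ⟨hFa.injective, hFs⟩
  have hEs : LipschitzWith K E.symm := hFa.to_rightInverse E.right_inv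
  refine ⟨⟨E, hFl.continuous, hEs.continuous⟩, ?_, hFl, hEs⟩
  refine hFd (R := 0) (m' := fun i => (A i).pt) (.of_forall fun i => (dist_self _).le) ?_ ?_
  · simp only [(hf _).map_pt]
    exact tendsto_const_nhds
  · simp only [he, (hh _).map_pt]
    exact tendsto_const_nhds

end PointedMetricSpace

/-! ### Compactness of balls -/

/-- The Hopf-Rinow theorem in the form of Cohn-Vossen: a complete locally compact metric space in
which distances are approximately realized by intermediate points has compact balls. -/
theorem isCompact_closedBall_of_approx_intermediate {M : Type*} [MetricSpace M] [CompleteSpace M]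
    [LocallyCompactSpace M]
    (hM : ∀ (x y : M) (r δ : ℝ), 0 ≤ r → 0 < δ → dist x y < r + δ →
      ∃ z, dist x z ≤ r ∧ dist z y ≤ δ) (p : M) (R : ℝ) : IsCompact (closedBall p R) := by
  by_contra hR
  have hmono : ∀ {r s : ℝ}, r ≤ s → IsCompact (closedBall p s) → IsCompact (closedBall p r) :=
    fun hrs hs => hs.of_isClosed_subset isClosed_closedBall (closedBall_subset_closedBall hrs)
  set S : Set ℝ := {r | IsCompact (closedBall p r)}
  have h0 : (0 : ℝ) ∈ S := by simp [S]
  have hbdd : BddAbove S := ⟨R, fun r hr => le_of_not_gt fun h => hR (hmono h.le hr)⟩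
  have hs0 : 0 ≤ sSup S := le_csSup hbdd h0
  have hlt : ∀ r < sSup S, IsCompact (closedBall p r) := by
    intro r hr
    obtain ⟨s, hs, hrs⟩ := exists_lt_of_lt_csSup ⟨0, h0⟩ hr
    exact hmono hrs.le hs
  -- The supremum is attained: the ball lies within `2 * δ ≤ η / 2` of a smaller compact ball, which
  -- has a finite `η / 4`-net.
  have hsup : IsCompact (closedBall p (sSup S)) := by
    rcases hs0.eq_or_lt with h | hspos
    · rw [← h]; exact h0
    refine TotallyBounded.isCompact_of_isClosed ?_ isClosed_closedBall
    rw [Metric.totallyBounded_iff]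
    intro η hη
    set δ := min (η / 4) (sSup S)
    have hδ : 0 < δ := lt_min (by positivity) hspos
    have hδη : δ ≤ η / 4 := min_le_left _ _
    have hδs : δ ≤ sSup S := min_le_right _ _
    obtain ⟨t, htf, ht⟩ := Metric.totallyBounded_iff.1
      (hlt (sSup S - δ) (by linarith)).totallyBounded (η / 4) (by positivity)
    refine ⟨t, htf, fun y hy => ?_⟩
    rw [mem_closedBall, dist_comm] at hy
    obtain ⟨z, hz1, hz2⟩ := hM p y (sSup S - δ) (2 * δ) (by linarith) (by linarith) (by linarith)
    obtain ⟨w, hw, hzw⟩ := mem_iUnion₂.1 (ht (mem_closedBall'.2 hz1))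
    refine mem_iUnion₂.2 ⟨w, hw, ?_⟩
    have := dist_triangle_left y w z
    rw [mem_ball] at hzw ⊢
    linarith
  -- Local compactness thickens the compact ball, so a radius beyond the supremum also works: a
  -- contradiction.
  obtain ⟨δ, hδ, hc⟩ := hsup.exists_isCompact_cthickening
  have hmem : sSup S + δ / 2 ∈ S := by
    refine hc.of_isClosed_subset isClosed_closedBall fun y hy => ?_
    rw [mem_closedBall, dist_comm] at hy
    obtain ⟨z, hz1, hz2⟩ := hM p y (sSup S) δ hs0 hδ (by linarith)
    exact mem_cthickening_of_dist_le y z δ _ (mem_closedBall'.2 hz1) (by rwa [dist_comm])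
  have := le_csSup hbdd hmem
  linarith

/-! ### Gronwall estimate -/

/-- The product `exp (-c * s) * f s` has nonpositive derivative. No sign of `f` is needed, so the
lower bound follows by applying this to `-f` and `-C`. -/
theorem le_exp_mul_of_deriv_le {f : ℝ → ℝ} {T c : ℝ}
    (hf : ∀ t ∈ Icc 0 T, ∃ D, HasDerivWithinAt f D (Icc 0 T) t ∧ D ≤ c * f t) {t : ℝ}
    (ht : t ∈ Icc 0 T) : f t ≤ Real.exp (c * t) * f 0 := by
  have hd : ∀ s ∈ Icc 0 T, ∃ D ≤ 0,
      HasDerivWithinAt (fun s => Real.exp (-c * s) * f s) D (Icc 0 T) s := by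
    intro s hs
    obtain ⟨D, hD, hDle⟩ := hf s hs
    have he : HasDerivWithinAt (fun s => Real.exp (-c * s))
        (Real.exp (-c * s) * (-c * 1)) (Icc 0 T) s :=
      ((hasDerivAt_id s).const_mul (-c)).exp.hasDerivWithinAt
    refine ⟨_, ?_, he.mul hD⟩
    have := mul_nonpos_of_nonneg_of_nonpos (Real.exp_pos (-c * s)).le
      (show D - c * f s ≤ 0 by linarith)
    linarith
  choose! D hD hDd using hd
  have hanti : AntitoneOn (fun s => Real.exp (-c * s) * f s) (Icc 0 T) :=
    antitoneOn_of_hasDerivWithinAt_nonpos (convex_Icc 0 T)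
      (fun s hs => (hDd s hs).continuousWithinAt)
      (fun s hs => (hDd s (interior_subset hs)).mono interior_subset)
      fun s hs => hD s (interior_subset hs)
  have h := hanti ⟨le_rfl, ht.1.trans ht.2⟩ ht ht.1
  simp only [mul_zero, Real.exp_zero, one_mul, neg_mul, Real.exp_neg] at h
  rwa [inv_mul_le_iff₀ (Real.exp_pos _)] at h

/-- A function whose derivative is bounded by a multiple of its value changes at most
exponentially. -/
theorem le_exp_mul_of_abs_deriv_le {f : ℝ → ℝ} {T C : ℝ}
    (hf : ∀ t ∈ Icc 0 T, ∃ D, HasDerivWithinAt f D (Icc 0 T) t ∧ |D| ≤ C * f t) {t : ℝ}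
    (ht : t ∈ Icc 0 T) :
    f t ≤ Real.exp (C * t) * f 0 ∧ f 0 ≤ Real.exp (C * t) * f t := by
  refine ⟨le_exp_mul_of_deriv_le (fun s hs => ?_) ht, ?_⟩
  · obtain ⟨D, hD, hle⟩ := hf s hs
    exact ⟨D, hD, (abs_le.1 hle).2⟩
  · have h := le_exp_mul_of_deriv_le (f := fun s => -f s) (c := -C) (fun s hs => by
      obtain ⟨D, hD, hle⟩ := hf s hs
      exact ⟨-D, hD.neg, by linarith [(abs_le.1 hle).1]⟩) ht
    rw [neg_mul, Real.exp_neg, mul_neg, neg_le_neg_iff, inv_mul_le_iff₀ (Real.exp_pos _)] at h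
    exact h

/-! ### Comparison of Riemannian distances -/

namespace SmoothRiemannianMetric

variable {n : ℕ} {M : Type*} [TopologicalSpace M]
  [ChartedSpace (EuclideanSpace ℝ (Fin n)) M] [IsManifold (𝓡 n) ∞ M]

theorem norm_tangent_eq_sqrt (g : SmoothRiemannianMetric n M) (q : M)
    (V : TangentSpace (𝓡 n) q) :
    letI : RiemannianBundle (fun x : M => TangentSpace (𝓡 n) x) := ⟨g.toRiemannianMetric⟩
    ‖V‖ = √(g.inner q V V) := by
  let _ : RiemannianBundle (fun x : M => TangentSpace (𝓡 n) x) := ⟨g.toRiemannianMetric⟩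
  exact norm_eq_sqrt_real_inner V

theorem inner_self_nonneg (g : SmoothRiemannianMetric n M) (q : M) (V : TangentSpace (𝓡 n) q) :
    0 ≤ g.inner q V V := by
  rcases eq_or_ne V 0 with rfl | hV
  · simp
  · exact (g.pos q V hV).le

/-- The length of a path on `[0, 1]` for a Riemannian metric. -/
noncomputable def length (g : SmoothRiemannianMetric n M) (γ : ℝ → M) : ENNReal :=
  letI : RiemannianBundle (fun x : M => TangentSpace (𝓡 n) x) := ⟨g.toRiemannianMetric⟩
  pathELength (𝓡 n) γ 0 1

theorem length_eq_lintegral (g : SmoothRiemannianMetric n M) (γ : ℝ → M) :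
    g.length γ = ∫⁻ t in Icc (0 : ℝ) 1, ENNReal.ofReal
      √(g.inner (γ t) (mfderiv 𝓘(ℝ, ℝ) (𝓡 n) γ t 1) (mfderiv 𝓘(ℝ, ℝ) (𝓡 n) γ t 1)) := by
  let _ : RiemannianBundle (fun x : M => TangentSpace (𝓡 n) x) := ⟨g.toRiemannianMetric⟩
  rw [length, pathELength_eq_lintegral_mfderiv_Icc]
  refine MeasureTheory.lintegral_congr fun t => ?_
  rw [← g.norm_tangent_eq_sqrt, ofReal_norm]

variable [T2Space M]

theorem edist_le_length (g : SmoothRiemannianMetric n M) {γ : ℝ → M}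
    (hγ : ContMDiffOn 𝓘(ℝ, ℝ) (𝓡 n) 1 γ (Icc 0 1)) :
    g.toEMetricSpace.edist (γ 0) (γ 1) ≤ g.length γ := by
  let _ : RiemannianBundle (fun x : M => TangentSpace (𝓡 n) x) := ⟨g.toRiemannianMetric⟩
  exact riemannianEDist_le_pathELength hγ rfl rfl zero_le_one

theorem exists_length_lt (g : SmoothRiemannianMetric n M) {x y : M} {r : ENNReal}
    (h : g.toEMetricSpace.edist x y < r) :
    ∃ γ : ℝ → M, γ 0 = x ∧ γ 1 = y ∧ ContMDiffOn 𝓘(ℝ, ℝ) (𝓡 n) 1 γ (Icc 0 1) ∧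
      g.length γ < r := by
  let _ : RiemannianBundle (fun x : M => TangentSpace (𝓡 n) x) := ⟨g.toRiemannianMetric⟩
  exact exists_lt_of_riemannianEDist_lt h

/-- A pointwise comparison of two metrics gives a comparison of their distances. -/
theorem edist_le_mul {g h : SmoothRiemannianMetric n M} {L : ℝ≥0} (hL : L ≠ 0)
    (hgh : ∀ (q : M) (V : TangentSpace (𝓡 n) q), g.inner q V V ≤ (L : ℝ) ^ 2 * h.inner q V V)
    (x y : M) : g.toEMetricSpace.edist x y ≤ L * h.toEMetricSpace.edist x y := by
  have hlen : ∀ γ : ℝ → M, g.length γ ≤ L * h.length γ := by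
    intro γ
    rw [length_eq_lintegral, length_eq_lintegral,
      ← MeasureTheory.lintegral_const_mul' _ _ ENNReal.coe_ne_top]
    refine MeasureTheory.lintegral_mono fun t => ?_
    rw [← ENNReal.ofReal_coe_nnreal, ← ENNReal.ofReal_mul L.coe_nonneg]
    refine ENNReal.ofReal_le_ofReal ?_
    rw [Real.sqrt_le_left (by positivity), mul_pow]
    refine (hgh _ _).trans (mul_le_mul_of_nonneg_left ?_ (by positivity))
    exact (Real.sqrt_le_left (Real.sqrt_nonneg _)).1 le_rfl
  have hL0 : (L : ENNReal) ≠ 0 := ENNReal.coe_ne_zero.2 hL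
  refine le_of_not_gt fun hlt => ?_
  rw [mul_comm, ← ENNReal.lt_div_iff_mul_lt (.inl hL0) (.inl ENNReal.coe_ne_top)] at hlt
  obtain ⟨γ, rfl, rfl, hγ, hγlt⟩ := h.exists_length_lt hlt
  rw [ENNReal.lt_div_iff_mul_lt (.inl hL0) (.inl ENNReal.coe_ne_top), mul_comm] at hγlt
  exact absurd hγlt (not_lt.2 ((g.edist_le_length hγ).trans (hlen γ)))

/-- Riemannian distances are approximately realized by intermediate points. -/
theorem exists_intermediate (g : SmoothRiemannianMetric n M) {x y : M} {r δ : ENNReal}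
    (hd : g.toEMetricSpace.edist x y < r + δ) :
    ∃ z, g.toEMetricSpace.edist x z ≤ r ∧ g.toEMetricSpace.edist z y ≤ δ := by
  have : IsManifold (𝓡 n) 1 M := IsManifold.of_le (n := ∞) (by norm_cast)
  have : LocallyCompactSpace M := ChartedSpace.locallyCompactSpace (EuclideanSpace ℝ (Fin n)) M
  let : RiemannianBundle (fun x : M => TangentSpace (𝓡 n) x) := ⟨g.toRiemannianMetric⟩
  have : IsContinuousRiemannianBundle (EuclideanSpace ℝ (Fin n))
      (fun x : M => TangentSpace (𝓡 n) x) := ⟨⟨g.inner, g.contMDiff.continuous, fun _ _ _ => rfl⟩⟩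
  let := g.toEMetricSpace
  change edist x y < r + δ at hd
  change ∃ z, edist x z ≤ r ∧ edist z y ≤ δ
  have hED : ∀ a b : M, edist a b = riemannianEDist (𝓡 n) a b := fun _ _ => rfl
  rcases le_or_gt (edist x y) r with h | h
  · exact ⟨y, h, by simp⟩
  obtain ⟨γ, h0, h1, hγ, hlen⟩ := exists_lt_of_riemannianEDist_lt ((hED x y).symm.trans_lt hd)
  have hc : ContinuousOn (fun t => edist x (γ t)) (Icc 0 1) :=
    (continuous_const.edist continuous_id).comp_continuousOn hγ.continuousOn
  -- Cut a nearly minimizing path at distance exactly `r` from `x`: the first piece has length at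
  -- least `r`, leaving at most `δ` for the rest.
  obtain ⟨t, ht, hr⟩ := intermediate_value_Icc zero_le_one hc
    (show r ∈ Icc (edist x (γ 0)) (edist x (γ 1)) by simp [h0, h1, h.le])
  refine ⟨γ t, hr.le, ?_⟩
  have hl1 : r ≤ pathELength (𝓡 n) γ 0 t := by
    refine (hr.symm.trans (hED x (γ t))).trans_le ?_
    exact riemannianEDist_le_pathELength (hγ.mono (Icc_subset_Icc_right ht.2)) h0 rfl ht.1
  have hl2 : edist (γ t) y ≤ pathELength (𝓡 n) γ t 1 := by
    rw [hED]
    exact riemannianEDist_le_pathELength (hγ.mono (Icc_subset_Icc_left ht.1)) rfl h1 ht.2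
  rw [← pathELength_add ht.1 ht.2] at hlen
  refine hl2.trans (le_of_not_gt fun hlt => ?_)
  exact absurd hlen (not_lt.2 (add_le_add hl1 hlt.le))

variable [ConnectedSpace M]

theorem lipschitzWith_refl_toPointed {g h : SmoothRiemannianMetric n M} {L : ℝ≥0} (hL : L ≠ 0)
    (hgh : ∀ (q : M) (V : TangentSpace (𝓡 n) q), g.inner q V V ≤ (L : ℝ) ^ 2 * h.inner q V V)
    (p : M) : LipschitzWith (α := (h.toPointed p).carrier) (β := (g.toPointed p).carrier) L
      (Equiv.refl M) :=
  edist_le_mul (M := M) hL hgh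

/-- A complete connected Riemannian manifold has compact balls. -/
theorem isCompact_closedBall_toPointed (g : SmoothRiemannianMetric n M) (p : M)
    [hg : CompleteSpace (g.toPointed p).carrier] (R : ℝ) :
    IsCompact (closedBall (g.toPointed p).pt R) := by
  have : LocallyCompactSpace (g.toPointed p).carrier :=
    ChartedSpace.locallyCompactSpace (EuclideanSpace ℝ (Fin n)) M
  refine isCompact_closedBall_of_approx_intermediate (fun x y r δ hr hδ hd => ?_) _ R
  obtain ⟨z, h1, h2⟩ := g.exists_intermediate (x := x) (y := y) (r := .ofReal r) (δ := .ofReal δ)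
    (by
      rw [← ENNReal.ofReal_add hr hδ.le]
      exact (edist_lt_ofReal (α := (g.toPointed p).carrier)).2 hd)
  exact ⟨z, (edist_le_ofReal (α := (g.toPointed p).carrier) hr).1 h1,
    (edist_le_ofReal (α := (g.toPointed p).carrier) hδ.le).1 h2⟩

end SmoothRiemannianMetric

/-! ### The bi-Lipschitz limit maps -/

theorem proposition4p2 {n : ℕ} {T C : ℝ}
    {M : ℕ → Type*} [∀ i, TopologicalSpace (M i)]
    [∀ i, ChartedSpace (EuclideanSpace ℝ (Fin n)) (M i)] [∀ i, IsManifold (𝓡 n) ∞ (M i)]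
    [∀ i, T2Space (M i)] [∀ i, ConnectedSpace (M i)]
    (g : ∀ i, ℝ → SmoothRiemannianMetric n (M i)) (p : ∀ i, M i)
    (hcomplete : ∀ i, ∀ t ∈ Icc 0 T, CompleteSpace ((g i t).toPointed (p i)).carrier)
    (hderiv : ∀ i, ∀ t ∈ Icc 0 T, ∀ (q : M i) (V : TangentSpace (𝓡 n) q),
      ∃ D : ℝ, HasDerivWithinAt (fun s => (g i s).inner q V V) D (Icc 0 T) t ∧
        |D| ≤ C * (g i t).inner q V V)
    (X : ℝ → PointedMetricSpace)
    (hX : ∀ t ∈ Icc 0 T, CompleteSpace (X t).carrier)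
    (hlim : ∀ t ∈ Icc 0 T,
      PointedMetricSpace.GHTendsto (fun i => (g i t).toPointed (p i)) (X t)) :
    ∃ K : ℝ≥0, ∀ t ∈ Icc 0 T, ∃ f : (X t).carrier ≃ₜ (X 0).carrier,
      f (X t).pt = (X 0).pt ∧ LipschitzWith K f ∧ LipschitzWith K f.symm := by
  -- Only `exp (C * t) ≤ L ^ 2` is needed, as metrics scale by the square of distances; this `L` is
  -- not optimal.
  set L : ℝ≥0 := ⟨Real.exp (|C| * T), (Real.exp_pos _).le⟩
  have hL : L ≠ 0 := fun h => (Real.exp_pos (|C| * T)).ne' (congrArg NNReal.toReal h)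
  refine ⟨L, fun t ht => ?_⟩
  have hT : 0 ≤ T := ht.1.trans ht.2
  have h0 : (0 : ℝ) ∈ Icc 0 T := ⟨le_rfl, hT⟩
  have hexp : Real.exp (C * t) ≤ (L : ℝ) ^ 2 := by
    change _ ≤ Real.exp (|C| * T) ^ 2
    rw [← Real.exp_nat_mul, Real.exp_le_exp]
    have h1 : C * t ≤ |C| * T := by
      gcongr
      exacts [ht.1, le_abs_self C, ht.2]
    have h2 : 0 ≤ |C| * T := by positivity
    push_cast
    linarith
  have hcmp := fun i q (V : TangentSpace (𝓡 n) q) =>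
    le_exp_mul_of_abs_deriv_le (fun s hs => hderiv i s hs q V) ht
  have := hX t ht
  have := hX 0 h0
  refine (hlim t ht).exists_homeomorph (hlim 0 h0)
    (fun i R => ?_) (fun i R => ?_) (fun i => Equiv.refl (M i)) (fun _ => rfl) L
    (fun i => ?_) (fun i => ?_)
  · have := hcomplete i t ht
    exact (g i t).isCompact_closedBall_toPointed (p i) R
  · have := hcomplete i 0 h0
    exact (g i 0).isCompact_closedBall_toPointed (p i) R
  · exact SmoothRiemannianMetric.lipschitzWith_refl_toPointed hL (fun q V => (hcmp i q V).2.trans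
      (mul_le_mul_of_nonneg_right hexp ((g i t).inner_self_nonneg q V))) (p i)
  · exact SmoothRiemannianMetric.lipschitzWith_refl_toPointed hL (fun q V => (hcmp i q V).1.trans
      (mul_le_mul_of_nonneg_right hexp ((g i 0).inner_self_nonneg q V))) (p i)
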